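/- **Lemma 5.1.** Let $X$ be a Tychonoff space that is $F_\sigma$-quotient, i.e. there are a compact metrizable space $K$, an $F_\sigma$-subset $M\subset K$ (with the subspace topology) and a surjective quotient map $q:M\to X$. Then the function spaces $C_p(X)$ and $C_k(X)$ are $F_\sigma$-Lusin, and $C_{\downarrow F}(X)$ is $C_{\delta\sigma}$-Lusin. Here $C_p(X)$, $C_k(X)$ and $C_{\downarrow F}(X)$ denote the set $C(X)$ of continuous functions $f:X\to\mathbb R$ endowed, respectively, with the topology of pointwise convergence, with the compact-open topology, and with the Fell hypograph topology, which is generated by the subbase of all sets $\{f\in C(X):\max f(K)<r\}$ and $\{f\in C(X):\sup f(U)>r\}$, where $K\subset X$ is nonempty and compact, $U\subset X$ is nonempty and open, and $r\in\mathbb R$. For a class $\Gamma$ of sets in topological spaces, a topological space $Y$ is called $\Gamma$-Lusin if there are a Polish space $P$ and a continuous bijection $\xi:P\to Y$ such that for every open $U\subset P$ the set $(\xi^{-1})^{-1}(U)=\xi(U)$ is of class $\Gamma$ in $Y$. An $F_\sigma$-set is a countable union of closed sets; a constructible set is a member of the smallest algebra of sets containing all open sets; a $C_\delta$-set is a countable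 intersection of constructible sets; a $C_{\delta\sigma}$-set is a countable union of $C_\delta$-sets. -/

import Mathlib

open Set Topology

universe u

namespace FunctionSpaceLusin

/-- A class `Γ` of sets in topological spaces: for each topological space, a property of its
subsets. -/
abbrev SetClass : Type (u + 1) := ∀ (Z : Type u) [TopologicalSpace Z], Set Z → Prop

/-- `F_σ`-sets: countable unions of closed sets. -/
def FSigma : SetClass.{u} := fun Z _ A =>
  ∃ F : ℕ → Set Z, (∀ n, IsClosed (F n)) ∧ A = ⋃ n, F n

/-- Constructible sets: members of the smallest algebra of sets containing all open sets.
(This is not `Topology.IsConstructible`, which starts from retrocompact open sets.) -/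
def Constructible : SetClass.{u} := fun Z _ A =>
  A ∈ MeasureTheory.generateSetAlgebra {U : Set Z | IsOpen U}

/-- `C_δ`-sets: countable intersections of constructible sets. -/
def CDelta : SetClass.{u} := fun Z _ A =>
  ∃ C : ℕ → Set Z, (∀ n, Constructible Z (C n)) ∧ A = ⋂ n, C n

/-- `C_δσ`-sets: countable unions of `C_δ`-sets. -/
def CDeltaSigma : SetClass.{u} := fun Z _ A =>
  ∃ C : ℕ → Set Z, (∀ n, CDelta Z (C n)) ∧ A = ⋃ n, C n

/-- A map is `Γ`-measurable if preimages of open sets are of class `Γ`. -/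
def ClassMeasurable (Γ : SetClass.{u}) {Y Z : Type u} [TopologicalSpace Y] [TopologicalSpace Z]
    (f : Y → Z) : Prop :=
  ∀ U : Set Z, IsOpen U → Γ Y (f ⁻¹' U)

/-- `Y` is `Γ`-Lusin: it is the image of a Polish space `P` under a continuous bijection whose
inverse map `Y → P` is `Γ`-measurable. -/
def IsLusinOfClass (Γ : SetClass.{u}) (Y : Type u) [TopologicalSpace Y] : Prop :=
  ∃ (P : Type u) (_ : TopologicalSpace P) (_ : PolishSpace P) (ξ : P ≃ Y),
    Continuous ξ ∧ ClassMeasurable Γ ξ.symm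

/-- `X` is `Γ`-quotient: it is the image, under a surjective quotient map, of a subspace of
class `Γ` of a compact metrizable space. (Compact metrizable spaces have at most continuum many
points, so the choice of the universe of `K` does not matter.) -/
def IsQuotientOfClass (Γ : SetClass.{u}) (X : Type u) [TopologicalSpace X] : Prop :=
  ∃ (K : Type u) (_ : TopologicalSpace K) (_ : CompactSpace K)
    (_ : TopologicalSpace.MetrizableSpace K) (M : Set K) (q : M → X),
    Γ K M ∧ IsQuotientMap q

/-- `C_p(X)`: the continuous real-valued functions on `X`, with the topology of pointwise
convergence. -/
def Cp (X : Type u) [TopologicalSpace X] : Type u := C(X, ℝ)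

instance (X : Type u) [TopologicalSpace X] : FunLike (Cp X) X ℝ :=
  inferInstanceAs (FunLike C(X, ℝ) X ℝ)

instance (X : Type u) [TopologicalSpace X] : TopologicalSpace (Cp X) :=
  TopologicalSpace.induced (fun (f : Cp X) (x : X) => f x) Pi.topologicalSpace

/-- `C_k(X)`: the continuous real-valued functions on `X`, with the compact-open topology, which
is Mathlib's topology on `C(X, ℝ)`. -/
abbrev Ck (X : Type u) [TopologicalSpace X] : Type u := C(X, ℝ)

/-- `C_{↓F}(X)`: the continuous real-valued functions on `X`, with the Fell hypograph topology. -/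
def CFell (X : Type u) [TopologicalSpace X] : Type u := C(X, ℝ)

instance (X : Type u) [TopologicalSpace X] : FunLike (CFell X) X ℝ :=
  inferInstanceAs (FunLike C(X, ℝ) X ℝ)

/-- The Fell hypograph topology has as a subbase the sets `{f | max f(K) < r}`, with `K` nonempty
and compact, and `{f | sup f(U) > r}`, with `U` nonempty and open, for real `r`. As the maximum is
attained, `max f(K) < r` means `f x < r` on `K`; as `sup f(U) ∈ (-∞, ∞]` is a least upper bound,
`sup f(U) > r` means `r < f x` for some `x ∈ U`. -/
instance (X : Type u) [TopologicalSpace X] : TopologicalSpace (CFell X) :=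
  TopologicalSpace.generateFrom
    ({S | ∃ (K : Set X) (r : ℝ), IsCompact K ∧ K.Nonempty ∧ S = {f : CFell X | ∀ x ∈ K, f x < r}} ∪
     {S | ∃ (U : Set X) (r : ℝ), IsOpen U ∧ U.Nonempty ∧ S = {f : CFell X | ∃ x ∈ U, r < f x}})

end FunctionSpaceLusin

/- A function on `X` is determined by the restriction of `f ∘ q` to a countable dense set `D ⊆ M`.
The functions `D → ℝ` arising in this way form an `F_σδ`-set `⋂ i, ⋃ k, C i k` in `ℝ^D`: the closed
set `C (n, m) k` bounds by `1 / (m + 1)` the variation of the function over the `k`-th neighbourhood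
of the part of the kernel of `q` lying over the `n`-th compact set, which encodes continuity of the
extension to `M` and its constancy on the fibres of `q` at the same time. Recording for each `i`
also the least `k` gives a Polish space of codes. Convergence of codes freezes the moduli of
continuity, so decoding is continuous into the compact-open topology, the finest of the three. For
the inverse one only has to find the class of the sets where an evaluation is `< r` or `> r` and
where countably many differences of evaluations are bounded by a constant. -/

namespace FunctionSpaceLusin

/-- A family of sets closed under finite intersections and countable unions. The sets of one of the
classes `F_σ` and `C_δσ` form such a family, which is all the measurability arguments need. -/
structure IsSigmaLattice {Y : Type*} (𝓕 : Set (Set Y)) : Prop where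
  empty_mem : ∅ ∈ 𝓕
  univ_mem : univ ∈ 𝓕
  inter_mem : ∀ {A B : Set Y}, A ∈ 𝓕 → B ∈ 𝓕 → A ∩ B ∈ 𝓕
  iUnion_nat_mem : ∀ {A : ℕ → Set Y}, (∀ n, A n ∈ 𝓕) → ⋃ n, A n ∈ 𝓕

namespace IsSigmaLattice

variable {Y Z W : Type*} {𝓕 : Set (Set Y)}

theorem of_countable_unions {𝓖 : Set (Set Y)} (hempty : ∅ ∈ 𝓖) (huniv : univ ∈ 𝓖)
    (hinter : ∀ {A B : Set Y}, A ∈ 𝓖 → B ∈ 𝓖 → A ∩ B ∈ 𝓖) :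
    IsSigmaLattice {A | ∃ F : ℕ → Set Y, (∀ n, F n ∈ 𝓖) ∧ A = ⋃ n, F n} where
  empty_mem := ⟨fun _ => ∅, fun _ => hempty, iUnion_empty.symm⟩
  univ_mem := ⟨fun _ => univ, fun _ => huniv, (iUnion_const univ).symm⟩
  inter_mem := by
    rintro _ _ ⟨F, hF, rfl⟩ ⟨G, hG, rfl⟩
    refine ⟨fun n => F n.unpair.1 ∩ G n.unpair.2, fun n => hinter (hF _) (hG _), ?_⟩
    rw [iUnion_inter_iUnion, iUnion_unpair fun i j => F i ∩ G j]
  iUnion_nat_mem := by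
    intro A hA
    choose F hF hAF using hA
    refine ⟨fun n => F n.unpair.1 n.unpair.2, fun n => hF _ _, ?_⟩
    rw [iUnion_unpair F]
    exact iUnion_congr hAF

theorem iUnion_mem (h : IsSigmaLattice 𝓕) {ι : Sort*} [Countable ι] {A : ι → Set Y}
    (hA : ∀ i, A i ∈ 𝓕) : ⋃ i, A i ∈ 𝓕 := by
  cases isEmpty_or_nonempty ι
  · simpa using h.empty_mem
  · obtain ⟨g, hg⟩ := exists_surjective_nat ι
    rw [← hg.iUnion_comp]
    exact h.iUnion_nat_mem fun n => hA _

theorem union_mem (h : IsSigmaLattice 𝓕) {A B : Set Y} (hA : A ∈ 𝓕) (hB : B ∈ 𝓕) :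
    A ∪ B ∈ 𝓕 := by
  rw [union_eq_iUnion]
  exact h.iUnion_mem fun b => by cases b <;> assumption

theorem biInter_finset_mem (h : IsSigmaLattice 𝓕) {ι : Type*} (s : Finset ι) {A : ι → Set Y}
    (hA : ∀ i ∈ s, A i ∈ 𝓕) : ⋂ i ∈ s, A i ∈ 𝓕 := by
  classical
  induction s using Finset.induction_on with
  | empty => simpa using h.univ_mem
  | insert a s _ ih =>
    rw [Finset.set_biInter_insert]
    exact h.inter_mem (hA a (Finset.mem_insert_self a s))
      (ih fun i hi => hA i (Finset.mem_insert_of_mem hi))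

theorem preimage_mem_of_basis (h : IsSigmaLattice 𝓕) [TopologicalSpace Z]
    [SecondCountableTopology Z] {B : Set (Set Z)} (hB : TopologicalSpace.IsTopologicalBasis B)
    {f : Y → Z} (hf : ∀ b ∈ B, f ⁻¹' b ∈ 𝓕) {U : Set Z} (hU : IsOpen U) : f ⁻¹' U ∈ 𝓕 := by
  obtain ⟨S, hSB, rfl⟩ := hB.open_eq_sUnion hU
  obtain ⟨T, hT, hTS, hTU⟩ :=
    TopologicalSpace.isOpen_sUnion_countable S fun s hs => hB.isOpen (hSB hs)
  rw [← hTU, sUnion_eq_iUnion, preimage_iUnion]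
  have := hT.to_subtype
  exact h.iUnion_mem fun t => hf _ (hSB (hTS t.2))

theorem preimage_mem_of_real (h : IsSigmaLattice 𝓕) {f : Y → ℝ}
    (hlt : ∀ r, {y | f y < r} ∈ 𝓕) (hgt : ∀ r, {y | r < f y} ∈ 𝓕) {U : Set ℝ} (hU : IsOpen U) :
    f ⁻¹' U ∈ 𝓕 := by
  refine h.preimage_mem_of_basis Real.isTopologicalBasis_Ioo_rat ?_ hU
  intro b hb
  simp only [mem_iUnion, mem_singleton_iff] at hb
  obtain ⟨a, c, -, rfl⟩ := hb
  exact h.inter_mem (hgt a) (hlt c)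

theorem preimage_mem_of_countable (h : IsSigmaLattice 𝓕) [Countable Z] {f : Y → Z}
    (hf : ∀ k, {y | f y = k} ∈ 𝓕) (U : Set Z) : f ⁻¹' U ∈ 𝓕 := by
  have : f ⁻¹' U = ⋃ k : U, {y | f y = k} := by ext; simp
  rw [this]
  exact h.iUnion_mem fun k => hf k

theorem preimage_prodMk_mem (h : IsSigmaLattice 𝓕) [TopologicalSpace Z] [TopologicalSpace W]
    [SecondCountableTopology Z] [SecondCountableTopology W] {f : Y → Z} {g : Y → W}
    (hf : ∀ U, IsOpen U → f ⁻¹' U ∈ 𝓕) (hg : ∀ U, IsOpen U → g ⁻¹' U ∈ 𝓕)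
    {U : Set (Z × W)} (hU : IsOpen U) : (fun y => (f y, g y)) ⁻¹' U ∈ 𝓕 := by
  refine h.preimage_mem_of_basis (TopologicalSpace.isTopologicalBasis_opens.prod
    TopologicalSpace.isTopologicalBasis_opens) ?_ hU
  rintro _ ⟨V, hV, V', hV', rfl⟩
  exact h.inter_mem (hf V hV) (hg V' hV')

theorem preimage_pi_mem (h : IsSigmaLattice 𝓕) {ι : Type*} [Countable ι] [TopologicalSpace Z]
    [SecondCountableTopology Z] {f : Y → ι → Z} (hf : ∀ i U, IsOpen U → (f · i) ⁻¹' U ∈ 𝓕)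
    {U : Set (ι → Z)} (hU : IsOpen U) : f ⁻¹' U ∈ 𝓕 := by
  refine h.preimage_mem_of_basis (isTopologicalBasis_pi fun _ : ι =>
    TopologicalSpace.isTopologicalBasis_opens (α := Z)) ?_ hU
  rintro _ ⟨V, F, hV, rfl⟩
  have : f ⁻¹' (F : Set ι).pi V = ⋂ i ∈ F, (f · i) ⁻¹' V i := by ext; simp
  rw [this]
  exact h.biInter_finset_mem F fun i hi => hf i _ (hV i hi)

theorem setOfPred_lt_sub_mem (h : IsSigmaLattice 𝓕) {u v : Y → ℝ} (hu : ∀ r, {y | r < u y} ∈ 𝓕)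
    (hv : ∀ r, {y | v y < r} ∈ 𝓕) (c : ℝ) : {y | c < u y - v y} ∈ 𝓕 := by
  have : {y | c < u y - v y} = ⋃ r : ℚ, {y | c + r < u y} ∩ {y | v y < r} := by
    ext y
    simp only [mem_ofPred_eq, mem_iUnion, mem_inter_iff]
    constructor
    · intro hc
      obtain ⟨r, hvr, hru⟩ := exists_rat_btwn (show v y < u y - c by linarith)
      exact ⟨r, by linarith, hvr⟩
    · rintro ⟨r, hru, hvr⟩
      linarith
  rw [this]
  exact h.iUnion_mem fun r => h.inter_mem (hu _) (hv _)

theorem setOfPred_lt_abs_sub_mem (h : IsSigmaLattice 𝓕) {u v : Y → ℝ}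
    (hu_lt : ∀ r, {y | u y < r} ∈ 𝓕) (hu_gt : ∀ r, {y | r < u y} ∈ 𝓕)
    (hv_lt : ∀ r, {y | v y < r} ∈ 𝓕) (hv_gt : ∀ r, {y | r < v y} ∈ 𝓕) (c : ℝ) :
    {y | c < |u y - v y|} ∈ 𝓕 := by
  simp only [lt_abs, neg_sub, ofPred_or]
  exact h.union_mem (h.setOfPred_lt_sub_mem hu_gt hv_lt c) (h.setOfPred_lt_sub_mem hv_gt hu_lt c)

end IsSigmaLattice

section Classes

variable {Y : Type u} [TopologicalSpace Y]

theorem FSigma.of_isClosed {A : Set Y} (hA : IsClosed A) : FSigma Y A :=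
  ⟨fun _ => A, fun _ => hA, (iUnion_const A).symm⟩

theorem FSigma.preimage_of_isOpen {Z : Type*} [PseudoMetricSpace Z] {u : Y → Z}
    (hu : Continuous u) {V : Set Z} (hV : IsOpen V) : FSigma Y (u ⁻¹' V) := by
  obtain ⟨F, hF, -, rfl, -⟩ := hV.exists_iUnion_isClosed
  exact ⟨fun n => u ⁻¹' F n, fun n => (hF n).preimage hu, preimage_iUnion⟩

theorem FSigma.sigmaCompactSpace [CompactSpace Y] {A : Set Y} (hA : FSigma Y A) :
    SigmaCompactSpace A := by
  obtain ⟨F, hF, rfl⟩ := hA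
  exact isSigmaCompact_iff_sigmaCompactSpace.1
    (isSigmaCompact_iUnion_of_isCompact F fun n => (hF n).isCompact)

theorem isSigmaLattice_fSigma : IsSigmaLattice {A : Set Y | FSigma Y A} :=
  .of_countable_unions isClosed_empty isClosed_univ IsClosed.inter

theorem Constructible.of_isOpen {A : Set Y} (hA : IsOpen A) : Constructible Y A :=
  MeasureTheory.self_subset_generateSetAlgebra hA

theorem Constructible.compl {A : Set Y} (hA : Constructible Y A) : Constructible Y Aᶜ :=
  MeasureTheory.isSetAlgebra_generateSetAlgebra.compl_mem hA

theorem Constructible.union {A B : Set Y} (hA : Constructible Y A) (hB : Constructible Y B) :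
    Constructible Y (A ∪ B) :=
  MeasureTheory.isSetAlgebra_generateSetAlgebra.union_mem hA hB

theorem Constructible.cDelta {A : Set Y} (hA : Constructible Y A) : CDelta Y A :=
  ⟨fun _ => A, fun _ => hA, (iInter_const A).symm⟩

theorem CDelta.iInter {ι : Type*} [Countable ι] {A : ι → Set Y}
    (hA : ∀ i, CDelta Y (A i)) : CDelta Y (⋂ i, A i) := by
  cases isEmpty_or_nonempty ι
  · simpa using (Constructible.of_isOpen (Y := Y) isOpen_univ).cDelta
  · obtain ⟨g, hg⟩ := exists_surjective_nat ι
    rw [← hg.iInter_comp]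
    choose C hC hAC using hA
    refine ⟨fun n => C (g n.unpair.1) n.unpair.2, fun n => hC _ _, ?_⟩
    rw [iInter_unpair fun i j => C (g i) j]
    exact iInter_congr fun i => hAC _

theorem CDelta.inter {A B : Set Y} (hA : CDelta Y A) (hB : CDelta Y B) : CDelta Y (A ∩ B) := by
  rw [inter_eq_iInter]
  exact CDelta.iInter fun b => by cases b <;> assumption

theorem CDelta.cDeltaSigma {A : Set Y} (hA : CDelta Y A) : CDeltaSigma Y A :=
  ⟨fun _ => A, fun _ => hA, (iUnion_const A).symm⟩

theorem isSigmaLattice_cDeltaSigma : IsSigmaLattice {A : Set Y | CDeltaSigma Y A} :=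
  .of_countable_unions (𝓖 := {A | CDelta Y A}) (Constructible.of_isOpen isOpen_empty).cDelta
    (Constructible.of_isOpen isOpen_univ).cDelta CDelta.inter

theorem CDeltaSigma.setOfPred_lt_of_upperSemicontinuous {u : Y → ℝ} (hu : UpperSemicontinuous u)
    (r : ℝ) : CDeltaSigma Y {y | r < u y} := by
  refine ⟨fun n => {y | u y < r + 1 / (n + 1 : ℝ)}ᶜ,
    fun n => (Constructible.of_isOpen (hu.isOpen_preimage _)).compl.cDelta, ?_⟩
  ext y
  simp only [mem_ofPred_eq, mem_iUnion, mem_compl_iff, not_lt]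
  constructor
  · intro hr
    obtain ⟨n, hn⟩ := exists_nat_one_div_lt (sub_pos.2 hr)
    exact ⟨n, by linarith⟩
  · rintro ⟨n, hn⟩
    exact (lt_add_of_pos_right r Nat.one_div_pos_of_nat).trans_le hn

theorem CDelta.setOfPred_sub_le_of_upperSemicontinuous {u v : Y → ℝ} (hu : UpperSemicontinuous u)
    (hv : UpperSemicontinuous v) (c : ℝ) : CDelta Y {y | u y - v y ≤ c} := by
  have : {y | u y - v y ≤ c} = ⋂ r : ℚ, {y | v y < r}ᶜ ∪ {y | u y < c + r} := by
    ext y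
    simp only [mem_ofPred_eq, mem_iInter, mem_union, mem_compl_iff, ← imp_iff_not_or]
    constructor
    · intro h r hr
      linarith
    · intro h
      by_contra! hlt
      obtain ⟨r, hvr, hru⟩ := exists_rat_btwn (show v y < u y - c by linarith)
      linarith [h r hvr]
  rw [this]
  exact CDelta.iInter fun r => ((Constructible.of_isOpen (hv.isOpen_preimage _)).compl.union
    (.of_isOpen (hu.isOpen_preimage _))).cDelta

theorem CDelta.setOfPred_abs_sub_le_of_upperSemicontinuous {u v : Y → ℝ}
    (hu : UpperSemicontinuous u) (hv : UpperSemicontinuous v) (c : ℝ) :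
    CDelta Y {y | |u y - v y| ≤ c} := by
  simp only [abs_le', neg_sub, ofPred_and]
  exact (setOfPred_sub_le_of_upperSemicontinuous hu hv c).inter
    (setOfPred_sub_le_of_upperSemicontinuous hv hu c)

end Classes

section LeastIndex

variable {Z ι : Type*}

theorem polishSpace_iInter [TopologicalSpace Z] [T2Space Z] [Countable ι] [Nonempty ι]
    {A : ι → Set Z} (hA : ∀ i, PolishSpace (A i)) : PolishSpace ↥(⋂ i, A i) := by
  let diag : ↥(⋂ i, A i) → ∀ i, A i := fun z i => ⟨z, mem_iInter.1 z.2 i⟩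
  obtain ⟨i₀⟩ := ‹Nonempty ι›
  have hrange : range diag = ⋂ i, {w | (w i : Z) = w i₀} := by
    ext w
    simp only [mem_range, mem_iInter, mem_ofPred_eq]
    constructor
    · rintro ⟨z, rfl⟩ i
      rfl
    · intro hw
      refine ⟨⟨w i₀, mem_iInter.2 fun i => hw i ▸ (w i).2⟩, ?_⟩
      ext i
      exact (hw i).symm
  have hemb : IsEmbedding diag :=
    .of_comp (g := fun w => (w i₀ : Z)) (by fun_prop) (by fun_prop) IsEmbedding.subtypeVal
  refine IsClosedEmbedding.polishSpace (f := diag) ⟨hemb, ?_⟩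
  rw [hrange]
  exact isClosed_iInter fun i => isClosed_eq (by fun_prop) (by fun_prop)

theorem polishSpace_inter [TopologicalSpace Z] [T2Space Z] {A B : Set Z} (hA : PolishSpace A)
    (hB : PolishSpace B) : PolishSpace ↥(A ∩ B) := by
  rw [inter_eq_iInter]
  exact polishSpace_iInter fun b => by cases b <;> assumption

theorem isClosed_setOfPred_fst_mem {α : Type*} [TopologicalSpace Z] [TopologicalSpace α]
    [DiscreteTopology α] {C : α → Set Z} (hC : ∀ a, IsClosed (C a)) :
    IsClosed {p : Z × α | p.1 ∈ C p.2} := by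
  have : {p : Z × α | p.1 ∈ C p.2} = ⋂ a, {p | p.2 = a → p.1 ∈ C a} := by ext; simp
  rw [this]
  exact isClosed_iInter fun a =>
    isClosed_imp ((isOpen_discrete {a}).preimage continuous_snd) ((hC a).preimage continuous_fst)

/-- The graph of the map sending `z ∈ ⋂ i, ⋃ k, C i k` to the family of the least indices `k` with
`z ∈ C i k`. If the sets `C i k` are closed in a Polish space, this is a Polish space which maps
bijectively and continuously onto the `F_σδ`-set `⋂ i, ⋃ k, C i k`. -/
def leastIndexGraph (C : ι → ℕ → Set Z) : Set (Z × (ι → ℕ)) :=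
  {p | ∀ i, IsLeast {k | p.1 ∈ C i k} (p.2 i)}

variable {C : ι → ℕ → Set Z}

theorem polishSpace_leastIndexGraph [TopologicalSpace Z] [PolishSpace Z] [Countable ι] [Nonempty ι]
    (hC : ∀ i k, IsClosed (C i k)) : PolishSpace (leastIndexGraph C) := by
  have hmem (i : ι) : IsClosed {p : Z × ℕ | p.1 ∈ C i p.2} := isClosed_setOfPred_fst_mem (hC i)
  have hlt (i : ι) : IsClosed {p : Z × ℕ | p.1 ∈ ⋃ j ∈ Finset.range p.2, C i j} :=
    isClosed_setOfPred_fst_mem (C := fun k => ⋃ j ∈ Finset.range k, C i j)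
      fun k => isClosed_biUnion_finset fun j _ => hC i j
  have hcont (i : ι) : Continuous fun p : Z × (ι → ℕ) => (p.1, p.2 i) := by fun_prop
  have : leastIndexGraph C = ⋂ i, {p | p.1 ∈ C i (p.2 i)} ∩
      {p | p.1 ∈ ⋃ j ∈ Finset.range (p.2 i), C i j}ᶜ := by
    ext p
    simp only [leastIndexGraph, IsLeast, mem_lowerBounds, mem_ofPred_eq, mem_iInter, mem_inter_iff,
      mem_compl_iff, mem_iUnion, Finset.mem_range, exists_prop, not_exists, not_and, imp_not_comm,
      not_lt]
  rw [this]
  exact polishSpace_iInter fun i => polishSpace_inter ((hmem i).preimage (hcont i)).polishSpace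
    ((hlt i).preimage (hcont i)).isOpen_compl.polishSpace

/-- The bijection of `leastIndexGraph C` onto `⋂ i, ⋃ k, C i k`. -/
noncomputable def leastIndexEquiv (C : ι → ℕ → Set Z) :
    leastIndexGraph C ≃ {z // ∀ i, ∃ k, z ∈ C i k} where
  toFun p := ⟨p.1.1, fun i => ⟨_, (p.2 i).1⟩⟩
  invFun z := ⟨(z, fun i => sInf {k | (z : Z) ∈ C i k}),
    fun i => ⟨Nat.sInf_mem (z.2 i), fun _ => Nat.sInf_le⟩⟩
  left_inv p := by
    refine Subtype.ext (Prod.ext rfl (funext fun i => ?_))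
    exact IsLeast.unique ⟨Nat.sInf_mem ⟨_, (p.2 i).1⟩, fun _ => Nat.sInf_le⟩ (p.2 i)
  right_inv _ := rfl

theorem IsSigmaLattice.preimage_leastIndexGraph_mem {Y : Type*} {𝓕 : Set (Set Y)}
    (h : IsSigmaLattice 𝓕) [TopologicalSpace Z] [SecondCountableTopology Z] [Countable ι]
    {s : Y → leastIndexGraph C} (hs : ∀ V, IsOpen V → {y | (s y).1.1 ∈ V} ∈ 𝓕)
    (hmem : ∀ i k, {y | (s y).1.1 ∈ C i k} ∈ 𝓕) (hnotMem : ∀ i k, {y | (s y).1.1 ∉ C i k} ∈ 𝓕)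
    {U : Set (leastIndexGraph C)} (hU : IsOpen U) : s ⁻¹' U ∈ 𝓕 := by
  obtain ⟨V, hV, rfl⟩ := hU
  refine h.preimage_prodMk_mem hs (fun W hW => h.preimage_pi_mem (fun i O _ => ?_) hW) hV
  refine h.preimage_mem_of_countable (fun k => ?_) O
  have : {y | (s y).1.2 i = k} =
      {y | (s y).1.1 ∈ C i k} ∩ ⋂ j ∈ Finset.range k, {y | (s y).1.1 ∉ C i j} := by
    ext y
    simp only [mem_ofPred_eq, ← ((s y).2 i).isLeast_iff_eq, IsLeast, mem_lowerBounds, mem_inter_iff,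
      mem_iInter, Finset.mem_range, ← not_le, not_imp_not]
  rw [this]
  exact h.inter_mem (hmem i k) (h.biInter_finset_mem _ fun j _ => hnotMem i j)

end LeastIndex

section Extension

variable {M E : Type*} [TopologicalSpace M] {D : Set M}

theorem exists_continuousMap_extension [MetricSpace E] [CompleteSpace E] (hD : Dense D)
    {φ : D → E} (h : ∀ x : M, ∀ ε > 0, ∃ U ∈ 𝓝 x, ∀ y y' : D, (y : M) ∈ U → (y' : M) ∈ U →
      dist (φ y) (φ y') < ε) :
    ∃ g : C(M, E), ∀ y : D, g y = φ y := by
  have hlim (x : M) : ∃ c, Filter.Tendsto φ (Filter.comap Subtype.val (𝓝 x)) (𝓝 c) := by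
    have : (Filter.comap (Subtype.val : D → M) (𝓝 x)).NeBot :=
      hD.isDenseInducing_val.comap_nhds_neBot x
    refine cauchy_map_iff_exists_tendsto.1 (Metric.cauchy_iff.2 ⟨inferInstance, fun ε hε => ?_⟩)
    obtain ⟨U, hU, hφ⟩ := h x ε hε
    refine ⟨φ '' (Subtype.val ⁻¹' U), Filter.image_mem_map (Filter.preimage_mem_comap hU), ?_⟩
    rintro _ ⟨y, hy, rfl⟩ _ ⟨y', hy', rfl⟩
    exact hφ y y' hy hy'
  have hφ : Continuous φ := continuous_iff_continuousAt.2 fun y => by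
    obtain ⟨c, hc⟩ := hlim y
    rw [← hD.isDenseInducing_val.isInducing.nhds_eq_comap] at hc
    exact continuousAt_of_tendsto_nhds hc
  exact ⟨⟨hD.extend φ, hD.continuous_extend hlim⟩, hD.extend_eq hφ⟩

theorem continuous_of_continuous_uncurry_comp {X P : Type*} [TopologicalSpace X]
    [TopologicalSpace E] [TopologicalSpace P] [CompactlyCoherentSpace P] [R1Space P] {q : M → X}
    (hq : IsQuotientMap q) {F : P → C(X, E)} (hF : Continuous fun w : M × P => F w.2 (q w.1)) :
    Continuous F := by
  refine continuous_def.2 fun U hU => CompactlyCoherentSpace.isOpen_iff.2 fun Z hZ => ?_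
  have := isCompact_iff_compactSpace.1 hZ
  have hjoint : Continuous fun w : X × Z => F w.2 w.1 :=
    hq.continuous_lift_prod_left (hF.comp (continuous_id.prodMap continuous_subtype_val))
  exact hU.preimage (ContinuousMap.continuous_of_continuous_uncurry (fun z : Z => F z)
    (hjoint.comp continuous_swap))

end Extension

section Oscillation

variable {M : Type*}

/-- The closed set of those functions on `D` which vary by at most `1 / (m + 1)` over the pairs in
`N n k`, where `i = (n, m)`. -/
def oscSet (D : Set M) (N : ℕ → ℕ → Set (M × M)) (i : ℕ × ℕ) (k : ℕ) : Set (D → ℝ) :=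
  {φ | ∀ y y' : D, ((y : M), (y' : M)) ∈ N i.1 k → |φ y - φ y'| ≤ 1 / (i.2 + 1 : ℝ)}

theorem isClosed_oscSet {D : Set M} {N : ℕ → ℕ → Set (M × M)} (i : ℕ × ℕ) (k : ℕ) :
    IsClosed (oscSet D N i k) := by
  simp only [oscSet, ofPred_forall]
  exact isClosed_iInter fun y => isClosed_iInter fun y' => isClosed_iInter fun _ =>
    isClosed_le (by fun_prop) continuous_const

end Oscillation

section Coding

variable {M X : Type*} [TopologicalSpace M] [TopologicalSpace X]

/-- The open sets `N n k`, `k = 0, 1, …`, are neighbourhoods of a set `R n` such that `⋃ n, R n`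
contains the kernel of `q` and that every continuous function on `X`, viewed on `M`, varies little
over `N n k` for large `k`. The sets `R n` are encoded as `⋂ k, N n k`. -/
structure IsKernelGauge (q : M → X) (N : ℕ → ℕ → Set (M × M)) : Prop where
  isOpen : ∀ n k, IsOpen (N n k)
  exists_forall_mem : ∀ {x x' : M}, q x = q x' → ∃ n, ∀ k, (x, x') ∈ N n k
  exists_forall_abs_sub_lt : ∀ (f : C(X, ℝ)) (n : ℕ) {ε : ℝ}, 0 < ε →
    ∃ k, ∀ p ∈ N n k, |f (q p.1) - f (q p.2)| < ε

theorem exists_isKernelGauge [TopologicalSpace.PseudoMetrizableSpace M] [SigmaCompactSpace M]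
    {q : M → X} (hq : Continuous q) : ∃ N, IsKernelGauge q N := by
  let _ := TopologicalSpace.pseudoMetrizableSpacePseudoMetric M
  -- Unlike `q p.1 = q p.2`, these equations define a closed set even if `X` is not Hausdorff.
  let R (n : ℕ) : Set (M × M) := compactCovering M n ×ˢ compactCovering M n ∩
    ⋂ f : C(X, ℝ), {p | f (q p.1) = f (q p.2)}
  have hR (n : ℕ) : IsCompact (R n) :=
    ((isCompact_compactCovering M n).prod (isCompact_compactCovering M n)).inter_right
      (isClosed_iInter fun f => isClosed_eq (by fun_prop) (by fun_prop))
  refine ⟨fun n k => Metric.thickening (1 / (k + 1 : ℝ)) (R n), fun n k =>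
    Metric.isOpen_thickening, fun {x x'} hxx' => ?_, fun f n ε hε => ?_⟩
  · obtain ⟨n, hn⟩ := exists_mem_compactCovering x
    obtain ⟨n', hn'⟩ := exists_mem_compactCovering x'
    refine ⟨max n n', fun k =>
      Metric.self_subset_thickening Nat.one_div_pos_of_nat _ ⟨⟨?_, ?_⟩, ?_⟩⟩
    · exact compactCovering_subset M (le_max_left n n') hn
    · exact compactCovering_subset M (le_max_right n n') hn'
    · exact mem_iInter.2 fun f => congrArg f hxx'
  · have hopen : IsOpen {p : M × M | |f (q p.1) - f (q p.2)| < ε} :=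
      isOpen_lt (by fun_prop) continuous_const
    have hsub : R n ⊆ {p : M × M | |f (q p.1) - f (q p.2)| < ε} := fun p hp => by
      have hfp : f (q p.1) = f (q p.2) := mem_iInter.1 hp.2 f
      simpa [hfp] using hε
    obtain ⟨δ, hδ, hδsub⟩ := (hR n).exists_thickening_subset_open hopen hsub
    obtain ⟨k, hk⟩ := exists_nat_one_div_lt hδ
    exact ⟨k, (Metric.thickening_mono hk.le _).trans hδsub⟩

variable {q : M → X} {N : ℕ → ℕ → Set (M × M)} {D : Set M}

theorem abs_sub_le_of_mem_oscSet (hD : Dense D) {i : ℕ × ℕ} {k : ℕ} (hN : IsOpen (N i.1 k))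
    {g : C(M, ℝ)} (hg : D.domRestrict g ∈ oscSet D N i k) {z z' : M} (hz : (z, z') ∈ N i.1 k) :
    |g z - g z'| ≤ 1 / (i.2 + 1 : ℝ) := by
  have hclosed : IsClosed {p : M × M | |g p.1 - g p.2| ≤ 1 / (i.2 + 1 : ℝ)} :=
    isClosed_le (by fun_prop) continuous_const
  have hsub : N i.1 k ∩ D ×ˢ D ⊆ {p : M × M | |g p.1 - g p.2| ≤ 1 / (i.2 + 1 : ℝ)} :=
    fun p hp => hg ⟨p.1, hp.2.1⟩ ⟨p.2, hp.2.2⟩ hp.1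
  exact closure_minimal hsub hclosed ((hD.prod hD).open_subset_closure_inter hN hz)

namespace IsKernelGauge

theorem exists_mem_oscSet (hN : IsKernelGauge q N) (f : C(X, ℝ)) (i : ℕ × ℕ) :
    ∃ k, (fun y : D => f (q y)) ∈ oscSet D N i k := by
  obtain ⟨k, hk⟩ := hN.exists_forall_abs_sub_lt f i.1 (Nat.one_div_pos_of_nat (n := i.2))
  exact ⟨k, fun y y' hy => (hk _ hy).le⟩

theorem exists_nhds_prod_subset (hN : IsKernelGauge q N) (x : M) :
    ∃ n, ∀ k, ∃ U ∈ 𝓝 x, U ×ˢ U ⊆ N n k := by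
  obtain ⟨n, hn⟩ := hN.exists_forall_mem (rfl : q x = q x)
  refine ⟨n, fun k => ?_⟩
  obtain ⟨U, hU, V, hV, hUV⟩ := mem_nhds_prod_iff.1 ((hN.isOpen n k).mem_nhds (hn k))
  exact ⟨U ∩ V, Filter.inter_mem hU hV,
    (prod_mono inter_subset_left inter_subset_right).trans hUV⟩

theorem exists_extension (hN : IsKernelGauge q N) (hD : Dense D) {φ : D → ℝ}
    (hφ : ∀ i, ∃ k, φ ∈ oscSet D N i k) : ∃ g : C(M, ℝ), ∀ y : D, g y = φ y := by
  refine exists_continuousMap_extension hD fun x ε hε => ?_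
  obtain ⟨n, hn⟩ := hN.exists_nhds_prod_subset x
  obtain ⟨m, hm⟩ := exists_nat_one_div_lt hε
  obtain ⟨k, hk⟩ := hφ (n, m)
  obtain ⟨U, hU, hUN⟩ := hn k
  exact ⟨U, hU, fun y y' hy hy' => (hk y y' (hUN ⟨hy, hy'⟩)).trans_lt hm⟩

theorem eq_of_map_eq (hN : IsKernelGauge q N) (hD : Dense D) {g : C(M, ℝ)}
    (hg : ∀ i, ∃ k, D.domRestrict g ∈ oscSet D N i k) {x x' : M} (hx : q x = q x') :
    g x = g x' := by
  refine eq_of_forall_dist_le fun ε hε => ?_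
  obtain ⟨n, hn⟩ := hN.exists_forall_mem hx
  obtain ⟨m, hm⟩ := exists_nat_one_div_lt hε
  obtain ⟨k, hk⟩ := hg (n, m)
  exact (abs_sub_le_of_mem_oscSet hD (hN.isOpen n k) hk (hn k)).trans hm.le

theorem exists_continuousMap_comp_eq (hN : IsKernelGauge q N) (hD : Dense D) (hq : IsQuotientMap q)
    {φ : D → ℝ} (hφ : ∀ i, ∃ k, φ ∈ oscSet D N i k) :
    ∃ f : C(X, ℝ), (fun y : D => f (q y)) = φ := by
  obtain ⟨g, hg⟩ := hN.exists_extension hD hφ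
  obtain rfl : D.domRestrict g = φ := funext hg
  have hq' : IsQuotientMap (⟨q, hq.continuous⟩ : C(M, X)) := hq
  have hfib (x x' : M) (hx : q x = q x') : g x = g x' := hN.eq_of_map_eq hD hφ hx
  have hlift (z : M) : hq'.lift g hfib (q z) = g z := DFunLike.congr_fun (hq'.lift_comp g hfib) z
  exact ⟨hq'.lift g hfib, funext fun y : D => hlift y⟩

end IsKernelGauge

theorem restrict_comp_injective (hD : Dense D) (hq : Continuous q) (hsurj : q.Surjective) :
    Function.Injective fun (f : C(X, ℝ)) (y : D) => f (q y) := by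
  intro f f' hff'
  have heq : f ∘ q = f' ∘ q := Continuous.ext_on hD (by fun_prop) (by fun_prop)
    fun y hy => congrFun hff' ⟨y, hy⟩
  exact DFunLike.coe_injective (hsurj.injective_comp_right heq)

/-- Continuous functions on `X` correspond to the points of an `F_σδ`-set in `ℝ^D`. -/
noncomputable def restrictEquiv (hN : IsKernelGauge q N) (hD : Dense D) (hq : IsQuotientMap q) :
    C(X, ℝ) ≃ {φ : D → ℝ // ∀ i, ∃ k, φ ∈ oscSet D N i k} :=
  .ofBijective (fun f => ⟨fun y => f (q y), hN.exists_mem_oscSet f⟩)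
    ⟨fun _ _ h => restrict_comp_injective hD hq.continuous hq.surjective (congrArg Subtype.val h),
      fun φ => (hN.exists_continuousMap_comp_eq hD hq φ.2).imp fun _ => Subtype.ext⟩

/-- The bijection from codes to continuous functions, where a code consists of a function on `D` and
its moduli of continuity. -/
noncomputable def decode (hN : IsKernelGauge q N) (hD : Dense D) (hq : IsQuotientMap q) :
    leastIndexGraph (oscSet D N) ≃ C(X, ℝ) :=
  (leastIndexEquiv _).trans (restrictEquiv hN hD hq).symm

theorem decode_comp_eq_fst (hN : IsKernelGauge q N) (hD : Dense D) (hq : IsQuotientMap q)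
    (p : leastIndexGraph (oscSet D N)) : (fun y : D => decode hN hD hq p (q y)) = p.1.1 :=
  congrArg Subtype.val ((restrictEquiv hN hD hq).apply_symm_apply (leastIndexEquiv _ p))

theorem decode_symm_fst (hN : IsKernelGauge q N) (hD : Dense D) (hq : IsQuotientMap q)
    (f : C(X, ℝ)) : ((decode hN hD hq).symm f).1.1 = fun y : D => f (q y) := rfl

theorem abs_decode_sub_le (hN : IsKernelGauge q N) (hD : Dense D) (hq : IsQuotientMap q)
    (p : leastIndexGraph (oscSet D N)) (i : ℕ × ℕ) {z z' : M} (hz : (z, z') ∈ N i.1 (p.1.2 i)) :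
    |decode hN hD hq p (q z) - decode hN hD hq p (q z')| ≤ 1 / (i.2 + 1 : ℝ) := by
  let g : C(M, ℝ) := (decode hN hD hq p).comp ⟨q, hq.continuous⟩
  have hg : D.domRestrict g = p.1.1 := decode_comp_eq_fst hN hD hq p
  exact abs_sub_le_of_mem_oscSet (g := g) hD (hN.isOpen _ _) (hg ▸ (p.2 i).1) hz

theorem continuous_decode_eval (hN : IsKernelGauge q N) (hD : Dense D) (hq : IsQuotientMap q) :
    Continuous fun w : M × leastIndexGraph (oscSet D N) => decode hN hD hq w.2 (q w.1) := by
  refine continuous_iff_continuousAt.2 fun ⟨x, p₀⟩ => Metric.tendsto_nhds.2 fun ε hε => ?_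
  obtain ⟨n, hn⟩ := hN.exists_nhds_prod_subset x
  obtain ⟨m, hm⟩ := exists_nat_one_div_lt (show 0 < ε / 3 by positivity)
  obtain ⟨U, hU, hUN⟩ := hn (p₀.1.2 (n, m))
  obtain ⟨y, hyD, hyU⟩ := hD.inter_nhds_nonempty hU
  have hindex : ∀ᶠ p in 𝓝 p₀, p.1.2 (n, m) = p₀.1.2 (n, m) :=
    ((isOpen_discrete {p₀.1.2 (n, m)}).preimage (show Continuous
      fun p : leastIndexGraph (oscSet D N) => p.1.2 (n, m) by fun_prop)).mem_nhds rfl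
  have hvalue : ∀ᶠ p in 𝓝 p₀, dist (p.1.1 ⟨y, hyD⟩) (p₀.1.1 ⟨y, hyD⟩) < ε / 3 :=
    (show Continuous fun p : leastIndexGraph (oscSet D N) => p.1.1 ⟨y, hyD⟩ by
      fun_prop).continuousAt.eventually (Metric.ball_mem_nhds _ (by positivity))
  filter_upwards [(Filter.eventually_mem_set.2 hU).prod_nhds (hindex.and hvalue)]
  rintro ⟨z, p⟩ ⟨hz, hpi, hpv⟩
  have hpy : dist (decode hN hD hq p (q z)) (decode hN hD hq p (q y)) < ε / 3 :=
    (abs_decode_sub_le hN hD hq p (n, m) (hpi ▸ hUN ⟨hz, hyU⟩)).trans_lt hm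
  have hp₀y : dist (decode hN hD hq p₀ (q y)) (decode hN hD hq p₀ (q x)) < ε / 3 :=
    (abs_decode_sub_le hN hD hq p₀ (n, m) (hUN ⟨hyU, mem_of_mem_nhds hU⟩)).trans_lt hm
  have hpp₀ : dist (decode hN hD hq p (q y)) (decode hN hD hq p₀ (q y)) < ε / 3 := by
    rw [← decode_comp_eq_fst hN hD hq, ← decode_comp_eq_fst hN hD hq] at hpv
    exact hpv
  calc dist (decode hN hD hq p (q z)) (decode hN hD hq p₀ (q x))
      ≤ dist (decode hN hD hq p (q z)) (decode hN hD hq p (q y)) +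
        dist (decode hN hD hq p (q y)) (decode hN hD hq p₀ (q y)) +
        dist (decode hN hD hq p₀ (q y)) (decode hN hD hq p₀ (q x)) := dist_triangle4 _ _ _ _
    _ < ε := by linarith

theorem continuous_decode [Countable D] (hN : IsKernelGauge q N) (hD : Dense D)
    (hq : IsQuotientMap q) : Continuous (decode hN hD hq) :=
  continuous_of_continuous_uncurry_comp hq (continuous_decode_eval hN hD hq)

theorem IsSigmaLattice.preimage_decode_symm_mem {Y : Type*} {𝓕 : Set (Set Y)}
    (h : IsSigmaLattice 𝓕) [Countable D] (hN : IsKernelGauge q N) (hD : Dense D)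
    (hq : IsQuotientMap q) {F : Y → C(X, ℝ)} (hlt : ∀ x r, {y | F y x < r} ∈ 𝓕)
    (hgt : ∀ x r, {y | r < F y x} ∈ 𝓕)
    (hosc : ∀ (T : Set (X × X)) (c : ℝ), T.Countable →
      {y | ∀ t ∈ T, |F y t.1 - F y t.2| ≤ c} ∈ 𝓕)
    {U : Set (leastIndexGraph (oscSet D N))} (hU : IsOpen U) :
    (fun y => (decode hN hD hq).symm (F y)) ⁻¹' U ∈ 𝓕 := by
  refine h.preimage_leastIndexGraph_mem (fun V hV => ?_) (fun i k => ?_) (fun i k => ?_) hU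
  · exact h.preimage_pi_mem (f := fun z (y : D) => F z (q y))
      (fun y W hW => h.preimage_mem_of_real (hlt (q y)) (hgt (q y)) hW) hV
  · let T : Set (X × X) :=
      (fun y : D × D => (q y.1, q y.2)) '' {y | ((y.1 : M), (y.2 : M)) ∈ N i.1 k}
    convert! hosc T (1 / (i.2 + 1 : ℝ)) ((to_countable _).image _) using 1
    ext y
    simp only [decode_symm_fst, oscSet, T, mem_ofPred_eq, forall_mem_image, Prod.forall]
  · simp only [decode_symm_fst, oscSet, mem_ofPred_eq, not_forall, not_le, ofPred_exists]
    exact h.iUnion_mem fun y => h.iUnion_mem fun y' => h.iUnion_mem fun _ =>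
      h.setOfPred_lt_abs_sub_mem (hlt _) (hgt _) (hlt _) (hgt _) _

end Coding

section Lusin

variable {X M Y : Type u} [TopologicalSpace X] [TopologicalSpace M]
  [TopologicalSpace.PseudoMetrizableSpace M] [SigmaCompactSpace M] {q : M → X} [TopologicalSpace Y]

theorem isLusinOfClass_of_isSigmaLattice (hq : IsQuotientMap q) {Γ : SetClass.{u}}
    (hΓ : IsSigmaLattice {A | Γ Y A}) {e : C(X, ℝ) ≃ Y} (he : Continuous e)
    (hlt : ∀ x r, Γ Y {g | e.symm g x < r}) (hgt : ∀ x r, Γ Y {g | r < e.symm g x})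
    (hosc : ∀ (T : Set (X × X)) (c : ℝ), T.Countable →
      Γ Y {g | ∀ t ∈ T, |e.symm g t.1 - e.symm g t.2| ≤ c}) :
    IsLusinOfClass Γ Y := by
  let _ := TopologicalSpace.pseudoMetrizableSpacePseudoMetric M
  obtain ⟨N, hN⟩ := exists_isKernelGauge hq.continuous
  obtain ⟨D, hDc, hD⟩ := TopologicalSpace.exists_countable_dense M
  have := hDc.to_subtype
  exact ⟨leastIndexGraph (oscSet D N), inferInstance, polishSpace_leastIndexGraph isClosed_oscSet,
    (decode hN hD hq).trans e, he.comp (continuous_decode hN hD hq),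
    fun U hU => hΓ.preimage_decode_symm_mem hN hD hq hlt hgt hosc hU⟩

theorem isLusinOfClass_fSigma (hq : IsQuotientMap q) {e : C(X, ℝ) ≃ Y} (he : Continuous e)
    (heval : ∀ x, Continuous fun g => e.symm g x) : IsLusinOfClass FSigma Y := by
  refine isLusinOfClass_of_isSigmaLattice hq isSigmaLattice_fSigma he
    (fun x r => .preimage_of_isOpen (heval x) isOpen_Iio)
    (fun x r => .preimage_of_isOpen (heval x) isOpen_Ioi) fun T c _ => .of_isClosed ?_
  simp only [ofPred_forall]
  exact isClosed_biInter fun t _ =>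
    isClosed_le ((heval t.1).sub (heval t.2)).abs continuous_const

theorem isLusinOfClass_cDeltaSigma (hq : IsQuotientMap q) {e : C(X, ℝ) ≃ Y} (he : Continuous e)
    (heval : ∀ x, UpperSemicontinuous fun g => e.symm g x) : IsLusinOfClass CDeltaSigma Y := by
  refine isLusinOfClass_of_isSigmaLattice hq isSigmaLattice_cDeltaSigma he
    (fun x r => (Constructible.of_isOpen ((heval x).isOpen_preimage r)).cDelta.cDeltaSigma)
    (fun x r => .setOfPred_lt_of_upperSemicontinuous (heval x) r) fun T c hT => ?_
  have := hT.to_subtype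
  simp only [ofPred_forall]
  rw [biInter_eq_iInter]
  exact (CDelta.iInter fun t : T =>
    .setOfPred_abs_sub_le_of_upperSemicontinuous (heval t.1.1) (heval t.1.2) c).cDeltaSigma

end Lusin

section FunctionSpaces

variable (X : Type u) [TopologicalSpace X]

/-- The identity map of the set of continuous functions, from the compact-open topology to the
topology of pointwise convergence. -/
def cpEquiv : C(X, ℝ) ≃ Cp X := Equiv.refl _

/-- The identity map of the set of continuous functions, from the compact-open topology to the Fell
hypograph topology. -/
def cFellEquiv : C(X, ℝ) ≃ CFell X := Equiv.refl _

variable {X}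

theorem continuous_cpEquiv : Continuous (cpEquiv X) :=
  continuous_induced_rng.2 (continuous_pi fun x => continuous_eval_const x)

theorem continuous_cpEquiv_symm_apply (x : X) : Continuous fun g => (cpEquiv X).symm g x :=
  (continuous_apply x).comp continuous_induced_dom

theorem continuous_cFellEquiv : Continuous (cFellEquiv X) := by
  refine continuous_generateFrom_iff.2 ?_
  rintro _ (⟨K, r, hK, -, rfl⟩ | ⟨U, r, -, -, rfl⟩)
  · exact ContinuousMap.isOpen_setOfPred_mapsTo hK isOpen_Iio
  · have : cFellEquiv X ⁻¹' {f | ∃ x ∈ U, r < f x} = ⋃ x ∈ U, {f : C(X, ℝ) | r < f x} := by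
      ext f
      simp only [mem_preimage, mem_ofPred_eq, mem_iUnion, exists_prop]
      rfl
    rw [this]
    exact isOpen_biUnion fun x _ => isOpen_lt continuous_const (continuous_eval_const x)

theorem upperSemicontinuous_cFellEquiv_symm_apply (x : X) :
    UpperSemicontinuous fun g => (cFellEquiv X).symm g x := by
  refine upperSemicontinuous_iff_isOpen_preimage.2 fun r => .basic _ (.inl ?_)
  refine ⟨{x}, r, isCompact_singleton, singleton_nonempty x, ?_⟩
  ext f
  simp only [mem_preimage, mem_Iio, mem_ofPred_eq, mem_singleton_iff, forall_eq]
  rfl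

end FunctionSpaces

end FunctionSpaceLusin

theorem lemma5p1_general {X M : Type u} [TopologicalSpace X] [TopologicalSpace M]
    [TopologicalSpace.PseudoMetrizableSpace M] [SigmaCompactSpace M] {q : M → X}
    (hq : IsQuotientMap q) :
    FunctionSpaceLusin.IsLusinOfClass FunctionSpaceLusin.FSigma (FunctionSpaceLusin.Cp X) ∧
    FunctionSpaceLusin.IsLusinOfClass FunctionSpaceLusin.FSigma (FunctionSpaceLusin.Ck X) ∧
    FunctionSpaceLusin.IsLusinOfClass FunctionSpaceLusin.CDeltaSigma
      (FunctionSpaceLusin.CFell X) :=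
  open FunctionSpaceLusin in
  ⟨isLusinOfClass_fSigma hq continuous_cpEquiv continuous_cpEquiv_symm_apply,
    isLusinOfClass_fSigma hq (e := Equiv.refl _) continuous_id continuous_eval_const,
    isLusinOfClass_cDeltaSigma hq continuous_cFellEquiv upperSemicontinuous_cFellEquiv_symm_apply⟩

theorem lemma5p1 (X : Type u) [TopologicalSpace X] [T35Space X]
    (hX : FunctionSpaceLusin.IsQuotientOfClass FunctionSpaceLusin.FSigma X) :
    FunctionSpaceLusin.IsLusinOfClass FunctionSpaceLusin.FSigma (FunctionSpaceLusin.Cp X) ∧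
    FunctionSpaceLusin.IsLusinOfClass FunctionSpaceLusin.FSigma (FunctionSpaceLusin.Ck X) ∧
    FunctionSpaceLusin.IsLusinOfClass FunctionSpaceLusin.CDeltaSigma
      (FunctionSpaceLusin.CFell X) := by
  obtain ⟨K, _, _, _, M, q, hM, hq⟩ := hX
  have := hM.sigmaCompactSpace
  exact lemma5p1_general hq
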